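/- Let $\mathfrak H=\mathbb Q\langle x,y\rangle$ be the non-commutative polynomial algebra, $\mathfrak H^1=\mathbb Q+\mathfrak Hy$, $\mathfrak H^0=\mathbb Q+x\mathfrak Hy$, and let $\check{\mathfrak H}^1\subset\mathfrak H^1$ be the subspace spanned by all words of $\mathfrak H^1$ other than the powers of $y$. Put $z_k=x^{k-1}y$ for $k\ge 1$. For $k_1\ge 2$, $k_2,\dots,k_l\ge 1$ let $$\zeta^\star(k_1,\dots,k_l)=\sum_{m_1\ge\cdots\ge m_l>0}\frac1{m_1^{k_1}\cdots m_l^{k_l}},$$ and let $\overline Z\colon\mathfrak H^0\to\mathbb R$ be the $\mathbb Q$-linear map with $\overline Z(1)=1$ and $\overline Z(z_{k_1}\cdots z_{k_l})=\zeta^\star(k_1,\dots,k_l)$. Let $\gamma$ be the automorphism of $\mathfrak H$ with $\gamma(x)=x$, $\gamma(y)=x+y$, so that $\gamma^{-1}(x)=x$, $\gamma^{-1}(y)=y-x$. For $n\ge 1$ let $\mathfrak H$ act on $\mathfrak H^{\otimes(n+1)}$ by $$a\diamond(w_1\otimes\cdots\otimes w_{n+1})=w_1\otimes\cdots\otimes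 w_n\otimes aw_{n+1},\qquad (w_1\otimes\cdots\otimes w_{n+1})\diamond b=w_1b\otimes w_2\otimes\cdots\otimes w_{n+1},$$ let $\overline{\mathcal C}_n\colon\mathfrak H\to\mathfrak H^{\otimes(n+1)}$ be the unique $\mathbb Q$-linear map with $$\overline{\mathcal C}_n(x)=x\otimes y^{\otimes n},\quad \overline{\mathcal C}_n(y)=-(x\otimes y^{\otimes n}),\quad \overline{\mathcal C}_n(ww')=\overline{\mathcal C}_n(w)\diamond\gamma^{-1}(w')+\gamma^{-1}(w)\diamond\overline{\mathcal C}_n(w')\quad(w,w'\in\mathfrak H),$$ let $M_n\colon\mathfrak H^{\otimes(n+1)}\to\mathfrak H$ be the multiplication map $w_1\otimes\cdots\otimes w_{n+1}\mapsto w_1\cdots w_{n+1}$, and put $\overline\rho_n=M_n\circ\overline{\mathcal C}_n$. (1) For every $n\ge 1$, $\overline\rho_n(\check{\mathfrak H}^1)\subset\ker\overline Z$ (in particular $\overline\rho_n(\check{\mathfrak H}^1)\subset\mathfrak H^0$). (2) For $n=1$ this corresponds to the Ohno–Wakabayashi cyclic sum formula: for all $k_1,\dots,k_l\ge 1$, with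 $k=k_1+\cdots+k_l$, $$\overline\rho_1\bigl(\gamma(z_{k_1}\cdots z_{k_l})-x^{k}\bigr)=\sum_{j=1}^l\sum_{i=1}^{k_j-1}z_{k_j-i+1}z_{k_{j+1}}\cdots z_{k_l}z_{k_1}\cdots z_{k_{j-1}}z_i-k\,z_{k+1},$$ and, if moreover some $k_q>1$, $$\sum_{j=1}^l\sum_{i=1}^{k_j-1}\zeta^\star(k_j-i+1,k_{j+1},\dots,k_l,k_1,\dots,k_{j-1},i)=k\,\zeta(k+1).$$ -/

import Mathlib

open scoped TensorProduct

noncomputable section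

namespace CSF

/-- The two indeterminates. -/
inductive Letter where
  | x : Letter
  | y : Letter

/-- The non-commutative polynomial algebra `ℚ⟨x, y⟩`. -/
abbrev H : Type := FreeAlgebra ℚ Letter

def x : H := FreeAlgebra.ι ℚ Letter.x

def y : H := FreeAlgebra.ι ℚ Letter.y

/-- The monomial of `ℚ⟨x, y⟩` spelled by a list of letters. -/
def word (w : List Letter) : H := (w.map (FreeAlgebra.ι ℚ)).prod

/-- `z_k = x^{k-1} y` (used for `k ≥ 1`). -/
def z (k : ℕ) : H := x ^ (k - 1) * y

/-- `z_{k_1} z_{k_2} ⋯ z_{k_l}`. -/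
def zWord (k : List ℕ) : H := (k.map z).prod

/-- The subspace `ℚ + ℚ⟨x, y⟩ y`. -/
def H1 : Submodule ℚ H := Submodule.span ℚ {1} ⊔ LinearMap.range (LinearMap.mulRight ℚ y)

/-- The subspace `ℚ + x ℚ⟨x, y⟩ y`. -/
def H0 : Submodule ℚ H :=
  Submodule.span ℚ {1} ⊔ LinearMap.range (LinearMap.mulLeft ℚ x ∘ₗ LinearMap.mulRight ℚ y)

/-- The subspace spanned by the words of `ℚ + ℚ⟨x, y⟩ y` that are not powers of `y`. -/
def H1Check : Submodule ℚ H :=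
  Submodule.span ℚ {v : H | v ∈ H1 ∧ (∃ w : List Letter, v = word w) ∧ ∀ m : ℕ, v ≠ y ^ m}

/-- The basis of `ℚ⟨x, y⟩` consisting of the words. -/
def wordBasis : Module.Basis (FreeMonoid Letter) ℚ H := FreeAlgebra.basisFreeMonoid ℚ Letter

theorem wordBasis_apply (w : FreeMonoid Letter) : wordBasis w = word w.toList := by
  simp [wordBasis, FreeAlgebra.basisFreeMonoid, FreeAlgebra.equivMonoidAlgebraFreeMonoid,
    word, FreeMonoid.lift_apply]

/-! ### Multiple zeta-star values -/

/-- `ζ⋆(k_1, …, k_l) = ∑_{m_1 ≥ ⋯ ≥ m_l > 0} m_1^{-k_1} ⋯ m_l^{-k_l}`; the series converges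
when the list is empty, or when all entries are positive and the first one is at least `2`. -/
def zetaStar (k : List ℕ) : ℝ :=
  ∑' m : {m : Fin k.length → ℕ+ // Antitone m}, ∏ i, 1 / ((m.1 i : ℕ) : ℝ) ^ k.get i

/-- Reads the exponents off a word: `x^{k_1-1} y x^{k_2-1} y ⋯ x^{k_l-1} y` gives
`[k_1, …, k_l]`. The first argument counts the letters `x` read since the last `y`. -/
def exponentsAux : ℕ → List Letter → List ℕ
  | _, [] => []
  | c, Letter.x :: w => exponentsAux (c + 1) w
  | c, Letter.y :: w => (c + 1) :: exponentsAux 0 w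

def exponents (w : List Letter) : List ℕ := exponentsAux 0 w

/-- The linear map `Z̄ : ℚ + x ℚ⟨x, y⟩ y → ℝ` with `Z̄(1) = 1` and
`Z̄(x^{k_1-1} y ⋯ x^{k_l-1} y) = ζ⋆(k_1, …, k_l)`. -/
def Zbar : H0 →ₗ[ℚ] ℝ :=
  (wordBasis.constr ℚ (fun w => zetaStar (exponents w.toList))).domRestrict H0

/-! ### The operators -/

/-- The automorphism with `γ(x) = x`, `γ(y) = x + y`; its inverse sends `x` to `x` and `y` to
`y - x`. -/
def γ : H ≃ₐ[ℚ] H :=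
  AlgEquiv.ofAlgHom
    (FreeAlgebra.lift ℚ (fun u => match u with | Letter.x => x | Letter.y => x + y))
    (FreeAlgebra.lift ℚ (fun u => match u with | Letter.x => x | Letter.y => y - x))
    (by ext u; cases u <;> simp [x, y])
    (by ext u; cases u <;> simp [x, y])

/-- The tensor power `ℚ⟨x, y⟩^{⊗ (n+1)}`. -/
abbrev T (n : ℕ) : Type := ⨂[ℚ] _ : Fin (n + 1), H

/-- The left action `a ⋄ (w_1 ⊗ ⋯ ⊗ w_{n+1}) = w_1 ⊗ ⋯ ⊗ w_n ⊗ a w_{n+1}`. -/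
def lact (n : ℕ) : H →ₗ[ℚ] T n →ₗ[ℚ] T n :=
  (PiTensorProduct.mapMultilinear ℚ (fun _ : Fin (n + 1) => H) (fun _ => H)).toLinearMap
    (fun _ => LinearMap.id) (Fin.last n) ∘ₗ LinearMap.mul ℚ H

/-- The right action `(w_1 ⊗ ⋯ ⊗ w_{n+1}) ⋄ b = w_1 b ⊗ w_2 ⊗ ⋯ ⊗ w_{n+1}`, the acting element
being the first argument. -/
def ract (n : ℕ) : H →ₗ[ℚ] T n →ₗ[ℚ] T n :=
  (PiTensorProduct.mapMultilinear ℚ (fun _ : Fin (n + 1) => H) (fun _ => H)).toLinearMap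
    (fun _ => LinearMap.id) 0 ∘ₗ (LinearMap.mul ℚ H).flip

theorem lact_tprod (n : ℕ) (a : H) (w : Fin (n + 1) → H) :
    lact n a (PiTensorProduct.tprod ℚ w) =
      PiTensorProduct.tprod ℚ (Function.update w (Fin.last n) (a * w (Fin.last n))) := by
  simp only [lact, LinearMap.comp_apply, MultilinearMap.toLinearMap_apply,
    PiTensorProduct.mapMultilinear_apply, PiTensorProduct.map_tprod]
  congr 1
  ext i
  by_cases h : i = Fin.last n
  · subst h; simp
  · simp [h]

theorem ract_tprod (n : ℕ) (b : H) (w : Fin (n + 1) → H) :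
    ract n b (PiTensorProduct.tprod ℚ w) =
      PiTensorProduct.tprod ℚ (Function.update w 0 (w 0 * b)) := by
  simp only [ract, LinearMap.comp_apply, MultilinearMap.toLinearMap_apply,
    PiTensorProduct.mapMultilinear_apply, PiTensorProduct.map_tprod]
  congr 1
  ext i
  by_cases h : i = 0
  · subst h; simp
  · simp [h]

theorem lact_mul (n : ℕ) (a b : H) (t : T n) : lact n (a * b) t = lact n a (lact n b t) := by
  suffices h : lact n (a * b) = lact n a ∘ₗ lact n b by rw [h]; rfl
  ext w
  simp [lact_tprod, mul_assoc]

theorem ract_mul (n : ℕ) (a b : H) (t : T n) : ract n (a * b) t = ract n b (ract n a t) := by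
  suffices h : ract n (a * b) = ract n b ∘ₗ ract n a by rw [h]; rfl
  ext w
  simp [ract_tprod, mul_assoc]

theorem lact_ract (n : ℕ) (a b : H) (t : T n) :
    lact n a (ract n b t) = ract n b (lact n a t) := by
  suffices h : lact n a ∘ₗ ract n b = ract n b ∘ₗ lact n a from LinearMap.congr_fun h t
  ext w
  simp only [LinearMap.compMultilinearMap_apply, LinearMap.comp_apply, ract_tprod, lact_tprod]
  congr 1
  ext i
  by_cases h0 : (0 : Fin (n + 1)) = Fin.last n
  · rw [← h0]
    by_cases h : i = 0
    · subst h; simp [mul_assoc]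
    · simp [h]
  · rw [Function.update_of_ne (Ne.symm h0), Function.update_of_ne h0,
      Function.update_comm h0]

theorem lact_one (n : ℕ) (t : T n) : lact n 1 t = t := by
  suffices h : lact n 1 = LinearMap.id by rw [h]; rfl
  ext w
  simp [lact_tprod]

theorem ract_one (n : ℕ) (t : T n) : ract n 1 t = t := by
  suffices h : ract n 1 = LinearMap.id by rw [h]; rfl
  ext w
  simp [ract_tprod]

/-- `x ⊗ y^{⊗ n}`. -/
def xyTensor (n : ℕ) : T n := PiTensorProduct.tprod ℚ (Fin.cons x (fun _ : Fin n => y))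

def CbarLetter (n : ℕ) : Letter → T n
  | Letter.x => xyTensor n
  | Letter.y => -xyTensor n

def CbarWord (n : ℕ) : List Letter → T n
  | [] => 0
  | u :: w =>
      ract n (γ.symm (word w)) (CbarLetter n u) +
        lact n (γ.symm (FreeAlgebra.ι ℚ u)) (CbarWord n w)

/-- The twisted derivation `𝒞̄_n : ℚ⟨x, y⟩ → ℚ⟨x, y⟩^{⊗ (n+1)}`. It is the unique linear map with
`𝒞̄_n(x) = x ⊗ y^{⊗ n}`, `𝒞̄_n(y) = -(x ⊗ y^{⊗ n})` and
`𝒞̄_n(w w') = 𝒞̄_n(w) ⋄ γ⁻¹(w') + γ⁻¹(w) ⋄ 𝒞̄_n(w')`: see `Cbar_x`, `Cbar_y`, `Cbar_mul` and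
`Cbar_unique`. -/
def Cbar (n : ℕ) : H →ₗ[ℚ] T n := wordBasis.constr ℚ (fun w => CbarWord n w.toList)

/-- The multiplication map `w_1 ⊗ ⋯ ⊗ w_{n+1} ↦ w_1 ⋯ w_{n+1}`. -/
def M (n : ℕ) : T n →ₗ[ℚ] H :=
  PiTensorProduct.lift (MultilinearMap.mkPiAlgebraFin ℚ (n + 1) H)

/-- The operator `ρ̄_n = M_n ∘ 𝒞̄_n`. -/
def rhobar (n : ℕ) : H →ₗ[ℚ] H := M n ∘ₗ Cbar n

/-! ### The defining properties of `γ`, `M_n`, `𝒞̄_n` and `Z̄` -/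

theorem γ_x : γ x = x := by simp [γ, x]

theorem γ_y : γ y = x + y := by simp [γ, x, y]

theorem M_tprod (n : ℕ) (w : Fin (n + 1) → H) :
    M n (PiTensorProduct.tprod ℚ w) = (List.ofFn w).prod := by
  simp [M]


theorem Cbar_word (n : ℕ) (w : List Letter) : Cbar n (word w) = CbarWord n w := by
  have h := wordBasis.constr_basis ℚ (fun w => CbarWord n w.toList) (FreeMonoid.ofList w)
  rw [wordBasis_apply] at h
  exact h

theorem word_append (u v : List Letter) : word (u ++ v) = word u * word v := by
  simp [word]

theorem word_cons (a : Letter) (v : List Letter) :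
    word (a :: v) = FreeAlgebra.ι ℚ a * word v := by
  simp [word]

theorem word_nil : word [] = 1 := rfl

theorem Cbar_x (n : ℕ) : Cbar n x = xyTensor n := by
  have h := Cbar_word n [Letter.x]
  simpa [x, y, word, CbarWord, CbarLetter, ract_one] using h

theorem Cbar_y (n : ℕ) : Cbar n y = -xyTensor n := by
  have h := Cbar_word n [Letter.y]
  simpa [x, y, word, CbarWord, CbarLetter, ract_one] using h

theorem CbarWord_append (n : ℕ) (u v : List Letter) :
    CbarWord n (u ++ v) =
      ract n (γ.symm (word v)) (CbarWord n u) + lact n (γ.symm (word u)) (CbarWord n v) := by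
  induction u with
  | nil => simp [CbarWord, word_nil, lact_one]
  | cons a u ih =>
    simp only [List.cons_append, CbarWord, ih, word_append, word_cons, map_mul, map_add,
      ract_mul, lact_mul, lact_ract]
    abel

theorem Cbar_mul (n : ℕ) (w w' : H) :
    Cbar n (w * w') = ract n (γ.symm w') (Cbar n w) + lact n (γ.symm w) (Cbar n w') := by
  let A : H →ₗ[ℚ] H →ₗ[ℚ] T n := (LinearMap.mul ℚ H).compr₂ (Cbar n)
  let B : H →ₗ[ℚ] H →ₗ[ℚ] T n :=
    ((ract n ∘ₗ γ.symm.toLinearMap).flip ∘ₗ Cbar n) +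
      ((lact n ∘ₗ γ.symm.toLinearMap).compl₂ (Cbar n))
  have h : A = B := by
    refine wordBasis.ext fun u => wordBasis.ext fun v => ?_
    simp only [wordBasis_apply]
    change Cbar n (word u.toList * word v.toList) =
      ract n (γ.symm (word v.toList)) (Cbar n (word u.toList)) +
        lact n (γ.symm (word u.toList)) (Cbar n (word v.toList))
    rw [← word_append, Cbar_word, Cbar_word, Cbar_word, CbarWord_append]
  exact LinearMap.congr_fun (LinearMap.congr_fun h w) w'

theorem Cbar_unique (n : ℕ) (C : H →ₗ[ℚ] T n) (hx : C x = xyTensor n) (hy : C y = -xyTensor n)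
    (hmul : ∀ w w' : H, C (w * w') = ract n (γ.symm w') (C w) + lact n (γ.symm w) (C w')) :
    C = Cbar n := by
  have h1 : C 1 = 0 := by
    have h := hmul 1 1
    simpa [ract_one, lact_one] using h
  have hw : ∀ w : List Letter, C (word w) = CbarWord n w := by
    intro w
    induction w with
    | nil => simpa [CbarWord, word_nil] using h1
    | cons a w ih =>
      rw [word_cons, hmul, ih, CbarWord]
      congr 2
      cases a
      · exact hx
      · exact hy
  refine wordBasis.ext fun w => ?_
  rw [wordBasis_apply, hw, Cbar_word]

theorem exponentsAux_replicate (c m : ℕ) (w : List Letter) :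
    exponentsAux c (List.replicate m Letter.x ++ Letter.y :: w) =
      (c + m + 1) :: exponentsAux 0 w := by
  induction m generalizing c with
  | zero => simp [exponentsAux]
  | succ m ih =>
    simp only [List.replicate_succ, List.cons_append, exponentsAux, ih]
    congr 1
    omega

theorem zWord_eq_word (k : List ℕ) (hk : ∀ a ∈ k, 1 ≤ a) :
    ∃ w : List Letter, zWord k = word w ∧ exponents w = k := by
  induction k with
  | nil => exact ⟨[], rfl, rfl⟩
  | cons a k ih =>
    obtain ⟨w, hw, he⟩ := ih fun b hb => hk b (List.mem_cons_of_mem _ hb)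
    have ha : 1 ≤ a := hk a List.mem_cons_self
    refine ⟨List.replicate (a - 1) Letter.x ++ Letter.y :: w, ?_, ?_⟩
    · rw [word_append, word_cons, ← hw]
      simp [zWord, z, word, x, y, mul_assoc]
    · rw [exponents, exponentsAux_replicate]
      rw [exponents] at he
      rw [he]
      congr 1
      omega

theorem Zbar_zWord (k : List ℕ) (hk : ∀ a ∈ k, 1 ≤ a) (h0 : zWord k ∈ H0) :
    Zbar ⟨zWord k, h0⟩ = zetaStar k := by
  obtain ⟨w, hw, he⟩ := zWord_eq_word k hk
  have h := wordBasis.constr_basis ℚ (fun w => zetaStar (exponents w.toList))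
    (FreeMonoid.ofList w)
  rw [wordBasis_apply] at h
  rw [Zbar, LinearMap.domRestrict_apply]
  change wordBasis.constr ℚ (fun w => zetaStar (exponents w.toList)) (zWord k) = _
  rw [hw]
  refine h.trans ?_
  change zetaStar (exponents w) = _
  rw [he]

theorem zetaStar_nil : zetaStar [] = 1 := by
  have : Unique {m : Fin ([] : List ℕ).length → ℕ+ // Antitone m} :=
    { default := ⟨fun i => i.elim0, fun i => i.elim0⟩
      uniq := fun m => Subtype.ext (funext fun i => i.elim0) }
  rw [zetaStar, tsum_eq_single default (fun m hm => absurd (Subsingleton.elim _ _) hm)]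
  rfl

/-- The index `(k_j - i + 1, k_{j+1}, …, k_l, k_1, …, k_{j-1}, i)`, with `j` counted from `0`. -/
def cyclicIndex (k : List ℕ) (j : Fin k.length) (i : ℕ) : List ℕ :=
  (k.get j - i + 1) :: (k.drop (j + 1) ++ k.take j ++ [i])

end CSF

end

/-! The argument is a connected-sum argument. A word `w` in `x`, `y` acts on sequences through
`path`, with `m = p + 1` as summation variable: `x` divides by `m`, and `y` divides by `m` after
summing over smaller indices, strictly for `s = 0` and weakly for `s = 1`. So `zetaE s w` is the
zeta (`s = 0`) or zeta-star (`s = 1`) value of the word `x w y`. The weak sum minus its top term is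
the strict sum, so `y ↦ y - x` turns one action into the other, and `Z̄(x γ⁻¹(w) y) = zetaE 0 w`.

Closing a path from `p` to `q` by `1/(p - q)` instead gives the cyclic object `connE w`. Moving a
letter from one end of the word to the other changes it by exactly one zeta value: for `x` by
partial fractions (`connE_append_x`), for `y` by a telescoping series (`connE_cons_y`), with
opposite signs. These are the signs of `𝒞̄₁`, and `ρ̄₁(w)` is the signed sum of `x γ⁻¹(w') y` over
the words `w'` left after deleting a letter from `w` and rotating. Its image under `Z̄` therefore
telescopes around the cycle to zero, provided all `connE` are finite. This is so once `w` contains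
both letters, the span of such words being `mixed`.

For general `n`, `𝒞̄` kills `x + y` and `γ⁻¹(x + y) = y`, whence `ρ̄_{n+1}(v) = ρ̄₁(v (x + y)^n)`,
and `mixed` is stable under this multiplication. For the cyclic sum formula, `𝒞̄₁ ∘ γ` is an
untwisted derivation killing `y`, which makes the left side explicit; subtracting `x^k` removes the
only pure power of `x` in the expansion of `γ(z_{k_1} ⋯ z_{k_l})`. -/

noncomputable section

namespace CSF

open Finset ENNReal

/-! ### Operators on sequences attached to words -/

section Paths

variable {R : Type*} [CommSemiring R]

/-- The operators `f ↦ c f` (for `x`) and `f ↦ (p ↦ c(p) ∑_{r < p + s} f(r))` (for `y`) on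
sequences. -/
def step (c : ℕ → R) (s : ℕ) : Letter → Module.End R (ℕ → R)
  | Letter.x =>
    { toFun := fun f p => c p * f p
      map_add' := fun f g => by ext p; simp [mul_add]
      map_smul' := fun a f => by ext p; simp [mul_left_comm] }
  | Letter.y =>
    { toFun := fun f p => c p * ∑ r ∈ range (p + s), f r
      map_add' := fun f g => by ext p; simp [mul_add, sum_add_distrib]
      map_smul' := fun a f => by ext p; simp [mul_left_comm, mul_sum] }

/-- The composition of the operators `step` along a word. -/
def path (c : ℕ → R) (s : ℕ) (w : List Letter) : Module.End R (ℕ → R) :=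
  (w.map (step c s)).prod

theorem step_x (c : ℕ → R) (s : ℕ) (f : ℕ → R) (p : ℕ) :
    step c s Letter.x f p = c p * f p := rfl

theorem step_y (c : ℕ → R) (s : ℕ) (f : ℕ → R) (p : ℕ) :
    step c s Letter.y f p = c p * ∑ r ∈ range (p + s), f r := rfl

theorem path_nil (c : ℕ → R) (s : ℕ) (f : ℕ → R) : path c s [] f = f := by simp [path]

theorem path_cons (c : ℕ → R) (s : ℕ) (u : Letter) (w : List Letter) (f : ℕ → R) :
    path c s (u :: w) f = step c s u (path c s w f) := by simp [path]

theorem path_append (c : ℕ → R) (s : ℕ) (v w : List Letter) (f : ℕ → R) :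
    path c s (v ++ w) f = path c s v (path c s w f) := by simp [path]

theorem path_singleton (c : ℕ → R) (s : ℕ) (u : Letter) (f : ℕ → R) :
    path c s [u] f = step c s u f := by simp [path]

theorem path_congr_le (c : ℕ → R) (w : List Letter) {f g : ℕ → R} {p : ℕ}
    (h : ∀ q ≤ p, f q = g q) : path c 0 w f p = path c 0 w g p := by
  induction w generalizing p with
  | nil => simpa [path_nil] using h p le_rfl
  | cons u w ih =>
    rw [path_cons, path_cons]
    cases u
    · rw [step_x, step_x, ih h]
    · rw [step_y, step_y]
      congr 1
      refine sum_congr rfl fun r hr => ih fun q hq => h q ?_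
      have := mem_range.1 hr
      omega

/-- For `s = 0` indices never increase along a path, and each `y` lowers them strictly. -/
theorem path_congr_lt (c : ℕ → R) {w : List Letter} (hw : Letter.y ∈ w) {f g : ℕ → R} {p : ℕ}
    (h : ∀ q < p, f q = g q) : path c 0 w f p = path c 0 w g p := by
  induction w with
  | nil => simp at hw
  | cons u w ih =>
    rw [path_cons, path_cons]
    cases u
    · rw [step_x, step_x, ih (by simpa using hw)]
    · rw [step_y, step_y]
      congr 1
      refine sum_congr rfl fun r hr => path_congr_le c w fun q hq => h q ?_
      have := mem_range.1 hr
      omega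

end Paths

theorem path_mono (c : ℕ → ℝ≥0∞) (s : ℕ) (w : List Letter) {f g : ℕ → ℝ≥0∞} (h : f ≤ g) :
    path c s w f ≤ path c s w g := by
  induction w with
  | nil => simpa [path_nil] using h
  | cons u w ih =>
    rw [path_cons, path_cons]
    intro p
    cases u
    · exact mul_le_mul_right (ih p) _
    · exact mul_le_mul_right (sum_le_sum fun r _ => ih r) _

theorem path_tsum {ι : Type*} (c : ℕ → ℝ≥0∞) (s : ℕ) (w : List Letter) (f : ι → ℕ → ℝ≥0∞)
    (p : ℕ) : path c s w (fun q => ∑' i, f i q) p = ∑' i, path c s w (f i) p := by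
  induction w generalizing p with
  | nil => simp [path_nil]
  | cons u w ih =>
    simp only [path_cons]
    cases u
    · simp only [step_x, ih, ENNReal.tsum_mul_left]
    · simp only [step_y, ih, ENNReal.tsum_mul_left]
      rw [Summable.tsum_finsetSum fun _ _ => ENNReal.summable]

/-! ### Connected sums and the transport of one letter -/

/-- The sequence `p ↦ 1 / (p + 1)`. -/
def recip (p : ℕ) : ℝ≥0∞ := ((p + 1 : ℕ) : ℝ≥0∞)⁻¹

/-- The kernel `1 / (p - q)` for `q < p`. -/
def kern (p q : ℕ) : ℝ≥0∞ := if q < p then ((p - q : ℕ) : ℝ≥0∞)⁻¹ else 0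

/-- The series `∑ 1 / (p q)` over the paths from `p` to `q` spelled by `w`: a multiple zeta value
for `s = 0`, a multiple zeta-star value for `s = 1`. -/
def zetaE (s : ℕ) (w : List Letter) : ℝ≥0∞ := ∑' p, recip p * path recip s w recip p

/-- The connected sum `∑ 1 / (p - q)` over the paths from `p` to `q` spelled by `w`. -/
def connE (w : List Letter) : ℝ≥0∞ := ∑' p, path recip 0 w (kern p) p

theorem recip_eq_ofReal (n : ℕ) : recip n = ENNReal.ofReal (1 / (n + 1)) := by
  rw [recip, one_div, ENNReal.ofReal_inv_of_pos (by positivity)]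
  congr 1
  rw [← ENNReal.ofReal_natCast]
  push_cast
  rfl

theorem kern_add (q d : ℕ) : kern (q + d + 1) q = recip d := by
  rw [kern, if_pos (by omega), recip]
  congr 3
  omega

theorem kern_mul_recip {p q : ℕ} (h : q < p) :
    recip q * kern p q = recip p * kern p q + recip p * recip q := by
  obtain ⟨d, rfl⟩ := Nat.exists_eq_add_of_lt h
  rw [kern_add]
  simp only [recip_eq_ofReal]
  rw [← ENNReal.ofReal_mul (by positivity), ← ENNReal.ofReal_mul (by positivity),
    ← ENNReal.ofReal_mul (by positivity), ← ENNReal.ofReal_add (by positivity) (by positivity)]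
  congr 1
  push_cast
  field_simp
  ring

/-- Partial fractions under the sum, by `kern_mul_recip`. A `y` in `w` forces `q < p`; at `q = p`
the kernel vanishes and the identity fails. -/
theorem connE_append_x {w : List Letter} (hw : Letter.y ∈ w) :
    connE (w ++ [Letter.x]) = connE (Letter.x :: w) + zetaE 0 w := by
  rw [connE, connE, zetaE, ← ENNReal.tsum_add]
  congr 1
  ext p
  rw [path_append, path_singleton, path_cons, step_x]
  have h : recip p * path recip 0 w (kern p) p + recip p * path recip 0 w recip p =
      path recip 0 w (recip p • kern p + recip p • recip) p := by
    simp only [map_add, map_smul, Pi.add_apply, Pi.smul_apply, smul_eq_mul]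
  rw [h]
  refine path_congr_lt _ hw fun q hq => ?_
  simp [step_x, kern_mul_recip hq]

/-- Telescoping with lag `n` is a sum of `n` ordinary telescopings. -/
theorem hasSum_sub_add (f : ℕ → ℝ) (hf : Antitone f) (h0 : Filter.Tendsto f Filter.atTop (nhds 0))
    (n : ℕ) : HasSum (fun i => f i - f (i + n)) (∑ j ∈ range n, f j) := by
  induction n with
  | zero => simp
  | succ n ih =>
    rw [sum_range_succ]
    have h : HasSum (fun i => f (i + n) - f (i + n + 1)) (f n) := by
      rw [hasSum_iff_tendsto_nat_of_nonneg fun i => sub_nonneg.2 (hf (Nat.le_succ _))]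
      have := fun m => sum_range_sub' (fun i => f (i + n)) m
      simp only [zero_add, add_right_comm _ 1 n] at this
      simp only [this]
      have h1 := (tendsto_const_nhds (x := f n)).sub (h0.comp (Filter.tendsto_add_atTop_nat n))
      simpa using h1
    simpa [add_assoc] using ih.add h

theorem tsum_recip_mul_recip (a q : ℕ) :
    ∑' i, recip (a + i + (q + 1)) * recip (a + i) =
      recip q * ∑ j ∈ range (q + 1), recip (a + j) := by
  have hanti : Antitone fun i : ℕ => 1 / (((a + i : ℕ) : ℝ) + 1) := by
    intro i j hij
    dsimp only
    gcongr
  have hlim : Filter.Tendsto (fun i : ℕ => 1 / (((a + i : ℕ) : ℝ) + 1)) Filter.atTop (nhds 0) := by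
    have := (tendsto_one_div_add_atTop_nhds_zero_nat (𝕜 := ℝ)).comp
      (Filter.tendsto_add_atTop_nat a)
    refine this.congr fun i => ?_
    simp [add_comm]
  have h := (hasSum_sub_add _ hanti hlim (q + 1)).mul_left (1 / ((q : ℝ) + 1))
  have h2 : ∀ i : ℕ, recip (a + i + (q + 1)) * recip (a + i) = ENNReal.ofReal
      (1 / ((q : ℝ) + 1) * (1 / (((a + i : ℕ) : ℝ) + 1) -
        1 / (((a + (i + (q + 1)) : ℕ) : ℝ) + 1))) := by
    intro i
    rw [recip_eq_ofReal, recip_eq_ofReal, ← ENNReal.ofReal_mul (by positivity)]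
    congr 1
    push_cast
    field_simp
    ring
  simp only [h2]
  rw [← ENNReal.ofReal_tsum_of_nonneg _ h.summable, h.tsum_eq,
    ENNReal.ofReal_mul (by positivity), ENNReal.ofReal_sum_of_nonneg fun _ _ => by positivity]
  · simp only [recip_eq_ofReal]
  · intro i
    refine mul_nonneg (by positivity) (sub_nonneg.2 (hanti ?_))
    omega

theorem sum_range_kern (a q : ℕ) : ∑ r ∈ range q, kern (q + a) r = ∑ j ∈ range q, recip (a + j) := by
  rw [← sum_range_reflect]
  refine sum_congr rfl fun j hj => ?_
  have := mem_range.1 hj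
  rw [← kern_add (q - 1 - j)]
  congr 1
  omega

theorem tsum_sum_range_comm (g : ℕ → ℕ → ℝ≥0∞) :
    ∑' p, ∑ r ∈ range p, g p r = ∑' r, ∑' i, g (r + 1 + i) r := by
  have h : ∀ p, ∑ r ∈ range p, g p r = ∑' r, if r < p then g p r else 0 := by
    intro p
    rw [tsum_eq_sum (s := range p) (by simp_all)]
    exact sum_congr rfl fun r hr => by rw [if_pos (mem_range.1 hr)]
  simp only [h]
  rw [ENNReal.tsum_comm]
  congr 1
  ext r
  rw [← (add_right_injective (r + 1)).tsum_eq]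
  · congr 1
    ext i
    rw [if_pos (by omega)]
  · intro p hp
    have : r < p := by
      by_contra hc
      simp [hc] at hp
    exact ⟨p - (r + 1), by simp; omega⟩

/-- Summing over the starting index first, above the index `p` where `w` starts, gives a lagged
telescoping series: for `q ≤ p` it equals `recip q` times `q + 1` reciprocals. The first `q` of them
form the kernel sum of a `y` appended at the end; the last is `recip p` and yields the zeta value.
-/
theorem connE_cons_y (w : List Letter) :
    connE (Letter.y :: w) = connE (w ++ [Letter.y]) + zetaE 0 w := by
  have hl : connE (Letter.y :: w) =
      ∑' r, path recip 0 w (fun q => ∑' i, recip (r + 1 + i) * kern (r + 1 + i) q) r := by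
    rw [connE]
    simp only [path_cons, step_y, add_zero, mul_sum]
    rw [tsum_sum_range_comm]
    congr 1
    ext r
    rw [path_tsum]
    congr 1
    ext i
    have : (fun q => recip (r + 1 + i) * kern (r + 1 + i) q) =
        recip (r + 1 + i) • kern (r + 1 + i) := rfl
    rw [this, map_smul, Pi.smul_apply, smul_eq_mul]
  rw [hl, connE, zetaE, ← ENNReal.tsum_add]
  congr 1
  ext p
  rw [path_append, path_singleton, ← smul_eq_mul, ← Pi.smul_apply, ← map_smul, ← Pi.add_apply,
    ← map_add]
  refine path_congr_le _ w fun q hq => ?_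
  obtain ⟨a, rfl⟩ := Nat.exists_eq_add_of_le hq
  have h1 : ∀ i, recip (q + a + 1 + i) * kern (q + a + 1 + i) q =
      recip (a + i + (q + 1)) * recip (a + i) := by
    intro i
    rw [show q + a + 1 + i = q + (a + i) + 1 by ring, kern_add]
    congr 2
    ring
  simp only [h1]
  -- `sum_range_succ` splits off the term `j = q`, which is `recip p` with `p = q + a`.
  rw [tsum_recip_mul_recip, Pi.add_apply, step_y, add_zero, sum_range_kern, sum_range_succ,
    Pi.smul_apply, smul_eq_mul, mul_add, mul_comm (recip (q + a)), add_comm q a]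

/-! ### Convergence -/

/-- The weight `(p + 1)^{-3/4}`. -/
def wt (p : ℕ) : ℝ := ((p : ℝ) + 1) ^ (-(3 / 4) : ℝ)

theorem wt_pos (p : ℕ) : 0 < wt p := by unfold wt; positivity

theorem one_div_le_wt (p : ℕ) : 1 / ((p : ℝ) + 1) ≤ wt p := by
  rw [one_div, ← Real.rpow_neg_one, wt]
  exact Real.rpow_le_rpow_of_exponent_le (by linarith [Nat.cast_nonneg (α := ℝ) p]) (by norm_num)

theorem summable_wt_mul_wt : Summable fun p => wt p * wt p := by
  have h := (summable_nat_add_iff 1).2 (Real.summable_nat_rpow (p := -(3 / 2)).2 (by norm_num))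
  refine h.congr fun p => ?_
  rw [wt, ← Real.rpow_add (by positivity)]
  push_cast
  norm_num

/-- Comparison with `∫ t^(-3/4) dt = 4 t^(1/4)`, done algebraically: for consecutive fourth roots `b
≤ a`, `1 = a⁴ - b⁴ ≤ 4 a³ (a - b)`. -/
theorem sum_wt_le (p : ℕ) : ∑ r ∈ range (p + 1), wt r ≤ 4 * ((p : ℝ) + 1) * wt p := by
  have key : ∀ n : ℕ, ∑ r ∈ range n, wt r ≤ 4 * (n : ℝ) ^ (1 / 4 : ℝ) := by
    intro n
    induction n with
    | zero => simp
    | succ n ih =>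
      rw [sum_range_succ]
      set a : ℝ := ((n + 1 : ℕ) : ℝ) ^ (1 / 4 : ℝ) with ha
      set b : ℝ := (n : ℝ) ^ (1 / 4 : ℝ) with hb
      have ha0 : 0 < a := by positivity
      have hb0 : 0 ≤ b := by positivity
      have ha4 : a ^ 4 = n + 1 := by
        rw [ha, ← Real.rpow_natCast, ← Real.rpow_mul (by positivity)]
        norm_num
      have hb4 : b ^ 4 = n := by
        rw [hb, ← Real.rpow_natCast, ← Real.rpow_mul (by positivity)]
        norm_num
      have hba : b ≤ a := Real.rpow_le_rpow (by positivity) (by simp) (by norm_num)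
      have hw : wt n = (a ^ 3)⁻¹ := by
        rw [ha, ← Real.rpow_natCast, ← Real.rpow_mul (by positivity),
          ← Real.rpow_neg (by positivity), wt]
        norm_num
      rw [hw]
      have h1 : (a ^ 3)⁻¹ ≤ 4 * (a - b) := by
        rw [inv_le_iff_one_le_mul₀ (by positivity)]
        have h2 : (a - b) * (a ^ 3 + a ^ 2 * b + a * b ^ 2 + b ^ 3) = 1 := by
          linear_combination ha4 - hb4
        have h3 : a ^ 3 + a ^ 2 * b + a * b ^ 2 + b ^ 3 ≤ 4 * a ^ 3 := by
          have e1 : a ^ 2 * b ≤ a ^ 2 * a := by gcongr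
          have e2 : a * b ^ 2 ≤ a * a ^ 2 := by gcongr
          have e3 : b ^ 3 ≤ a ^ 3 := by gcongr
          linarith [e1, e2, e3]
        have h4 := mul_le_mul_of_nonneg_left h3 (sub_nonneg.2 hba)
        linarith
      linarith
  refine (key (p + 1)).trans (le_of_eq ?_)
  have : ((p : ℝ) + 1) ^ (1 / 4 : ℝ) = ((p : ℝ) + 1) * wt p := by
    rw [wt]
    nth_rewrite 2 [← Real.rpow_one ((p : ℝ) + 1)]
    rw [← Real.rpow_add (by positivity)]
    norm_num
  push_cast
  rw [this]
  ring

theorem one_div_mul_sum_wt_le (p s : ℕ) (hs : s ≤ 1) :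
    1 / ((p : ℝ) + 1) * ∑ r ∈ range (p + s), wt r ≤ 4 * wt p := by
  have h1 : ∑ r ∈ range (p + s), wt r ≤ ∑ r ∈ range (p + 1), wt r :=
    sum_le_sum_of_subset_of_nonneg (by simpa using hs) fun r _ _ => (wt_pos r).le
  rw [one_div, inv_mul_le_iff₀ (by positivity)]
  linarith [sum_wt_le p]

/-- The weight `wt` with values in `[0, ∞]`. -/
def wtE (p : ℕ) : ℝ≥0∞ := ENNReal.ofReal (wt p)

theorem recip_le_wtE : recip ≤ wtE := fun p => by
  rw [recip_eq_ofReal]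
  exact ENNReal.ofReal_le_ofReal (one_div_le_wt p)

theorem tsum_wtE_mul_wtE_ne_top : ∑' p, wtE p * wtE p ≠ ⊤ := by
  have h := summable_wt_mul_wt.tsum_ofReal_ne_top
  simpa only [ENNReal.ofReal_mul (wt_pos _).le, wtE] using h

theorem recip_mul_sum_wtE_le (p : ℕ) {s : ℕ} (hs : s ≤ 1) :
    recip p * ∑ r ∈ range (p + s), wtE r ≤ 4 * wtE p := by
  have h := ENNReal.ofReal_le_ofReal (one_div_mul_sum_wt_le p s hs)
  rw [ENNReal.ofReal_mul (by positivity), ENNReal.ofReal_mul (by positivity),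
    ENNReal.ofReal_sum_of_nonneg fun r _ => (wt_pos r).le, ← recip_eq_ofReal] at h
  simpa [wtE] using h

theorem recip_le_one (p : ℕ) : recip p ≤ 1 := by
  rw [recip, ENNReal.inv_le_one]
  exact_mod_cast Nat.le_add_left 1 p

/-- Each letter preserves the weight up to a factor `4`, whereas on `recip` itself every `y` would
produce a logarithm. The exponent `3/4` lies below `1` for this bound and above `1/2` so that the
squared weight is summable. -/
theorem path_wtE_le {s : ℕ} (hs : s ≤ 1) (w : List Letter) :
    path recip s w wtE ≤ (4 ^ w.length : ℝ≥0∞) • wtE := by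
  induction w with
  | nil => simp [path_nil]
  | cons u w ih =>
    rw [path_cons]
    have h1 : step recip s u wtE ≤ (4 : ℝ≥0∞) • wtE := by
      intro p
      cases u
      · rw [step_x, Pi.smul_apply, smul_eq_mul]
        refine mul_le_mul_left ((recip_le_one p).trans ?_) _
        norm_num
      · exact recip_mul_sum_wtE_le p hs
    have h2 := path_mono recip s [u] ih
    rw [path_singleton, path_singleton, map_smul] at h2
    refine h2.trans ?_
    rw [List.length_cons, pow_succ, mul_smul]
    exact fun p => mul_le_mul_right (h1 p) _

theorem path_recip_le {s : ℕ} (hs : s ≤ 1) (w : List Letter) (p : ℕ) :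
    path recip s w recip p ≤ 4 ^ w.length * wtE p :=
  (path_mono recip s w recip_le_wtE p).trans (path_wtE_le hs w p)

theorem zetaE_ne_top {s : ℕ} (hs : s ≤ 1) (w : List Letter) : zetaE s w ≠ ⊤ := by
  refine ne_top_of_le_ne_top (b := 4 ^ w.length * ∑' p, wtE p * wtE p)
    (ENNReal.mul_ne_top (by simp) tsum_wtE_mul_wtE_ne_top) ?_
  rw [← ENNReal.tsum_mul_left]
  refine ENNReal.tsum_le_tsum fun p => ?_
  rw [mul_left_comm]
  exact mul_le_mul' (recip_le_wtE p) (path_recip_le hs w p)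

/-- Absorbs the kernel into the last letter at the price of a harmonic sum; a factor `recip p` from
a leading `x` then reduces that sum to the weight. -/
theorem step_kern_le (u : Letter) (p : ℕ) :
    step recip 0 u (kern p) ≤ (∑ r ∈ range p, kern p r) • recip := by
  intro q
  rw [Pi.smul_apply, smul_eq_mul, mul_comm]
  cases u
  · rw [step_x]
    refine mul_le_mul_right ?_ _
    by_cases h : q < p
    · exact single_le_sum_of_canonicallyOrdered (mem_range.2 h)
    · simp [kern, h]
  · rw [step_y]
    refine mul_le_mul_right (sum_le_sum_of_ne_zero fun r _ hr => ?_) _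
    by_contra h
    exact hr (if_neg (by simpa using h))

theorem recip_mul_sum_kern_le (p : ℕ) : recip p * ∑ r ∈ range p, kern p r ≤ 4 * wtE p := by
  have h := sum_range_kern 0 p
  simp only [add_zero, zero_add] at h
  rw [h]
  exact (mul_le_mul_right (sum_le_sum fun r _ => recip_le_wtE r) _).trans
    (recip_mul_sum_wtE_le p (Nat.zero_le 1))

theorem connE_cons_x_ne_top (w : List Letter) : connE (Letter.x :: w) ≠ ⊤ := by
  rcases List.eq_nil_or_concat w with rfl | ⟨w, u, rfl⟩
  · simp [connE, path_singleton, step_x, kern]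
  · refine ne_top_of_le_ne_top (b := 4 * 4 ^ w.length * ∑' p, wtE p * wtE p)
      (ENNReal.mul_ne_top (ENNReal.mul_ne_top (by simp) (by simp)) tsum_wtE_mul_wtE_ne_top) ?_
    rw [← ENNReal.tsum_mul_left]
    refine ENNReal.tsum_le_tsum fun p => ?_
    rw [List.concat_eq_append, path_cons, step_x, path_append, path_singleton]
    have h := path_mono recip 0 w (step_kern_le u p) p
    rw [map_smul, Pi.smul_apply, smul_eq_mul] at h
    calc _ ≤ recip p * ((∑ r ∈ range p, kern p r) * path recip 0 w recip p) :=
          mul_le_mul_right h _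
      _ = (recip p * ∑ r ∈ range p, kern p r) * path recip 0 w recip p := by ring
      _ ≤ (4 * wtE p) * (4 ^ w.length * wtE p) :=
          mul_le_mul' (recip_mul_sum_kern_le p) (path_recip_le (Nat.zero_le 1) w p)
      _ = _ := by ring

/-- Rotating a letter changes `connE` by a finite zeta value, so it suffices to rotate an `x` to the
front. -/
theorem connE_ne_top {w : List Letter} (hx : Letter.x ∈ w) (hy : Letter.y ∈ w) :
    connE w ≠ ⊤ := by
  obtain ⟨v, v', rfl⟩ := List.append_of_mem hx
  clear hx
  induction v generalizing v' with
  | nil => exact connE_cons_x_ne_top v'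
  | cons u v ih =>
    have h := ih (v' ++ [u]) (by simp at hy ⊢; tauto)
    rw [← List.cons_append, ← List.append_assoc] at h
    rw [List.cons_append]
    cases u
    · rw [connE_append_x (by simpa using hy)] at h
      exact (ENNReal.add_ne_top.1 h).1
    · rw [connE_cons_y]
      exact ENNReal.add_ne_top.2 ⟨h, zetaE_ne_top (Nat.zero_le 1) _⟩

/-! ### The signed rotation relation -/

/-- The sign of a letter in the cyclic derivation. -/
def sgn : Letter → ℚ
  | Letter.x => 1
  | Letter.y => -1

theorem sgn_mul_zetaE (u : Letter) {w : List Letter} (hx : Letter.x ∈ u :: w)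
    (hy : Letter.y ∈ u :: w) : (sgn u : ℝ) * (zetaE 0 w).toReal =
      (connE (w ++ [u])).toReal - (connE (u :: w)).toReal := by
  have h1 := connE_ne_top hx hy
  have h2 : connE (w ++ [u]) ≠ ⊤ := connE_ne_top (by simp at hx ⊢; tauto) (by simp at hy ⊢; tauto)
  have hz := zetaE_ne_top (Nat.zero_le 1) w
  cases u
  · rw [connE_append_x (by simpa using hy), ENNReal.toReal_add h1 hz]
    simp [sgn]
  · rw [connE_cons_y, ENNReal.toReal_add h2 hz]
    simp [sgn]

/-! ### The real operators -/

/-- The real sequence `p ↦ 1 / (p + 1)`. -/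
def recipR (p : ℕ) : ℝ := 1 / ((p : ℝ) + 1)

theorem recip_eq_ofReal_recipR (p : ℕ) : recip p = ENNReal.ofReal (recipR p) := recip_eq_ofReal p

theorem path_ofReal (s : ℕ) (w : List Letter) {f : ℕ → ℝ} (hf : 0 ≤ f) :
    0 ≤ path recipR s w f ∧ ∀ p, path recip s w (fun q => ENNReal.ofReal (f q)) p =
      ENNReal.ofReal (path recipR s w f p) := by
  induction w with
  | nil => simpa [path_nil] using hf
  | cons u w ih =>
    simp only [path_cons]
    have h0 : ∀ p, 0 ≤ recipR p := fun p => by unfold recipR; positivity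
    cases u
    · refine ⟨fun p => mul_nonneg (h0 p) (ih.1 p), fun p => ?_⟩
      rw [step_x, step_x, ih.2, recip_eq_ofReal_recipR, ← ENNReal.ofReal_mul (h0 p)]
    · refine ⟨fun p => mul_nonneg (h0 p) (sum_nonneg fun r _ => ih.1 r), fun p => ?_⟩
      rw [step_y, step_y, recip_eq_ofReal_recipR, sum_congr rfl fun r _ => ih.2 r,
        ← ENNReal.ofReal_sum_of_nonneg fun r _ => ih.1 r, ← ENNReal.ofReal_mul (h0 p)]

theorem hasSum_zetaE {s : ℕ} (hs : s ≤ 1) (w : List Letter) :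
    HasSum (fun p => recipR p * path recipR s w recipR p) (zetaE s w).toReal := by
  have h0 : 0 ≤ recipR := fun p => by unfold recipR; positivity
  have h := path_ofReal s w h0
  have h1 : ∀ p, recip p * path recip s w recip p =
      ENNReal.ofReal (recipR p * path recipR s w recipR p) := by
    intro p
    have : recip = fun q => ENNReal.ofReal (recipR q) := funext recip_eq_ofReal_recipR
    rw [ENNReal.ofReal_mul (h0 p), ← h.2, ← this, recip_eq_ofReal_recipR]
  have h2 := ENNReal.hasSum_toReal (zetaE_ne_top hs w)
  rw [← ENNReal.tsum_toReal_eq fun p => by rw [h1]; exact ENNReal.ofReal_ne_top] at h2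
  rw [zetaE]
  convert h2 using 2 with p
  rw [h1, ENNReal.toReal_ofReal (mul_nonneg (h0 p) (h.1 p))]

/-! ### Zeta-star values as iterated sums -/

/-- The sum of `∏ (m_i + 1)^{-k_i}` over the sequences `N ≥ m_1 ≥ ⋯ ≥ m_l ≥ 0`. -/
def starE : List ℕ → ℕ → ℝ≥0∞
  | [], _ => 1
  | a :: k, N => ∑ p ∈ range (N + 1), recip p ^ a * starE k p

/-- The part of the zeta-star series with prescribed largest summation index. -/
def headE : List ℕ → ℕ → ℝ≥0∞
  | [], _ => 0
  | a :: k, p => recip p ^ a * starE k p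

theorem starE_eq_sum_headE {k : List ℕ} (hk : k ≠ []) (N : ℕ) :
    starE k N = ∑ p ∈ range (N + 1), headE k p := by
  cases k with
  | nil => simp at hk
  | cons a k => rfl

theorem antitone_cons_iff {n : ℕ} (p : ℕ) (m : Fin n → ℕ) :
    Antitone (Fin.cons p m : Fin (n + 1) → ℕ) ↔ Antitone m ∧ ∀ i, m i ≤ p := by
  constructor
  · intro h
    refine ⟨fun i j hij => ?_, fun i => ?_⟩
    · simpa using h (Fin.succ_le_succ_iff.2 hij)
    · simpa using h (Fin.zero_le i.succ)
  · rintro ⟨h1, h2⟩ i j hij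
    induction j using Fin.cases with
    | zero =>
      rw [Fin.le_zero_iff.1 hij]
    | succ j =>
      induction i using Fin.cases with
      | zero => simpa using h2 j
      | succ i => simpa using h1 (Fin.succ_le_succ_iff.1 hij)

open Classical in
theorem tsum_antitone_cons (P : ℕ → Prop) (a : ℕ) (k : List ℕ) :
    ∑' m : Fin (k.length + 1) → ℕ, (if Antitone m ∧ P (m 0) then
        ∏ i, recip (m i) ^ (a :: k).get i else 0) =
      ∑' p, if P p then recip p ^ a * ∑' m : Fin k.length → ℕ,
        (if Antitone m ∧ ∀ i, m i ≤ p then ∏ i, recip (m i) ^ k.get i else 0) else 0 := by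
  rw [← (Fin.consEquiv fun _ : Fin (k.length + 1) => ℕ).tsum_eq, ENNReal.tsum_prod']
  congr 1
  ext p
  by_cases hp : P p
  · rw [if_pos hp, ← ENNReal.tsum_mul_left]
    congr 1
    ext m
    change (if Antitone (Fin.cons p m : Fin (k.length + 1) → ℕ) ∧ P p then _ else _) = _
    by_cases hm : Antitone m ∧ ∀ i, m i ≤ p
    · rw [if_pos ⟨(antitone_cons_iff p m).2 hm, hp⟩, if_pos hm]
      simp [Fin.prod_univ_succ, Fin.consEquiv_apply]
    · rw [if_neg fun h => hm ((antitone_cons_iff p m).1 h.1), if_neg hm, mul_zero]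
  · simp [Fin.consEquiv_apply, hp]

open Classical in
theorem tsum_antitone_le (k : List ℕ) (N : ℕ) :
    ∑' m : Fin k.length → ℕ, (if Antitone m ∧ ∀ i, m i ≤ N then
      ∏ i, recip (m i) ^ k.get i else 0) = starE k N := by
  induction k generalizing N with
  | nil =>
    have : Subsingleton (Fin ([] : List ℕ).length → ℕ) := ⟨fun f g => funext fun i => i.elim0⟩
    rw [tsum_eq_single (fun i => i.elim0) fun m hm => absurd (Subsingleton.elim _ _) hm]
    rw [if_pos ⟨fun i => i.elim0, fun i => i.elim0⟩]
    simp [starE]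
  | cons a k ih =>
    have h : ∀ m : Fin (k.length + 1) → ℕ, (Antitone m ∧ ∀ i, m i ≤ N) ↔
        (Antitone m ∧ m 0 ≤ N) := fun m =>
      and_congr_right fun hm => ⟨fun h => h 0, fun h i => (hm (Fin.zero_le i)).trans h⟩
    have h1 := tsum_antitone_cons (fun p => p ≤ N) a k
    simp only [← h, ih] at h1
    refine h1.trans ?_
    rw [starE, tsum_eq_sum (s := range (N + 1)) (by intro p hp; simp at hp; simp; omega)]
    refine sum_congr rfl fun p hp => ?_
    rw [if_pos (by simpa [Nat.lt_succ_iff] using hp)]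

/-- No convergence is assumed: for a divergent series both sides take the default value `0`. -/
theorem zetaStar_eq_tsum_headE {k : List ℕ} (hk : k ≠ []) :
    zetaStar k = (∑' p, headE k p).toReal := by
  classical
  cases k with
  | nil => simp at hk
  | cons a k =>
    let e : {m : Fin (a :: k).length → ℕ // Antitone m} ≃
        {m : Fin (a :: k).length → ℕ+ // Antitone m} :=
      (Equiv.arrowCongr (Equiv.refl _) Equiv.pnatEquivNat.symm).subtypeEquiv fun m => by
        refine ⟨fun h i j hij => ?_, fun h i j hij => ?_⟩
        · exact Nat.succPNat_le_succPNat.2 (h hij)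
        · exact Nat.succPNat_le_succPNat.1 (h hij)
    have h1 : ∀ m, ∏ i, 1 / (((e m).1 i : ℕ) : ℝ) ^ (a :: k).get i =
        (∏ i, recip (m.1 i) ^ (a :: k).get i).toReal := by
      intro m
      rw [ENNReal.toReal_prod]
      refine prod_congr rfl fun i _ => ?_
      rw [recip, ENNReal.toReal_pow, ENNReal.toReal_inv, ENNReal.toReal_natCast, one_div, inv_pow]
      rfl
    have h2 := tsum_antitone_cons (fun _ => True) a k
    simp only [and_true, if_true, tsum_antitone_le] at h2
    rw [zetaStar, ← e.tsum_eq]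
    simp only [h1]
    rw [← ENNReal.tsum_toReal_eq]
    · congr 1
      refine Eq.trans ?_ h2
      refine (tsum_subtype {m : Fin (k.length + 1) → ℕ | Antitone m}
        fun m => ∏ i, recip (m i) ^ (a :: k).get i).trans ?_
      congr 1
      ext m
      simp only [Set.indicator_apply, Set.mem_ofPred_eq]
    · intro m
      refine ENNReal.prod_ne_top fun i _ => ENNReal.pow_ne_top ?_
      exact ne_top_of_le_ne_top ENNReal.one_ne_top (recip_le_one _)

theorem exponentsAux_append_y_ne_nil (c : ℕ) (u : List Letter) :
    exponentsAux c (u ++ [Letter.y]) ≠ [] := by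
  induction u generalizing c with
  | nil => simp [exponentsAux]
  | cons b u ih => cases b <;> simp [exponentsAux, ih]

/-- The final `y` supplies the initial sequence `recip`, and the `c` pending letters `x` supply the
power of `recip p`. -/
theorem headE_exponentsAux (c : ℕ) (u : List Letter) (p : ℕ) :
    headE (exponentsAux c (u ++ [Letter.y])) p = recip p ^ c * path recip 1 u recip p := by
  induction u generalizing c p with
  | nil => simp [exponentsAux, headE, starE, path_nil, pow_succ]
  | cons b u ih =>
    rw [path_cons]
    cases b
    · rw [List.cons_append, exponentsAux, ih, step_x, pow_succ, mul_assoc]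
    · rw [List.cons_append, exponentsAux, headE,
        starE_eq_sum_headE (exponentsAux_append_y_ne_nil 0 u), step_y, pow_succ, mul_assoc]
      simp [ih]

theorem zetaStar_exponents (u : List Letter) :
    zetaStar (exponents (Letter.x :: (u ++ [Letter.y]))) = (zetaE 1 u).toReal := by
  rw [exponents, exponentsAux, zetaStar_eq_tsum_headE (exponentsAux_append_y_ne_nil _ u), zetaE]
  simp [headE_exponentsAux]

/-! ### The map `Z̄` -/

/-- The linear extension of `Z̄` to `ℚ⟨x, y⟩`. -/
def ZbarExt : H →ₗ[ℚ] ℝ := wordBasis.constr ℚ (fun w => zetaStar (exponents w.toList))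

theorem ZbarExt_word (w : List Letter) : ZbarExt (word w) = zetaStar (exponents w) := by
  have h := wordBasis.constr_basis ℚ (fun w => zetaStar (exponents w.toList)) (FreeMonoid.ofList w)
  rw [wordBasis_apply] at h
  exact h

theorem ZbarExt_zWord (k : List ℕ) (hk : ∀ a ∈ k, 1 ≤ a) : ZbarExt (zWord k) = zetaStar k := by
  obtain ⟨w, hw, he⟩ := zWord_eq_word k hk
  rw [hw, ZbarExt_word, he]

/-- The representation of `ℚ⟨x, y⟩` on sequences by which zeta-star values are computed. -/
def starRep : H →ₐ[ℚ] Module.End ℝ (ℕ → ℝ) := FreeAlgebra.lift ℚ (step recipR 1)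

theorem starRep_word (w : List Letter) : starRep (word w) = path recipR 1 w := by
  rw [word, map_list_prod, path, List.map_map]
  congr 2
  ext u : 1
  simp [starRep]

theorem γ_symm_x : γ.symm x = x := by rw [AlgEquiv.symm_apply_eq, γ_x]

theorem γ_symm_y : γ.symm y = y - x := by
  rw [AlgEquiv.symm_apply_eq, map_sub, γ_y, γ_x, add_sub_cancel_left]

theorem γ_symm_add : γ.symm (x + y) = y := by rw [map_add, γ_symm_x, γ_symm_y, add_sub_cancel]

/-- On `y`, this is the weak sum minus its diagonal term. The subtraction is why real sequences
replace `[0, ∞]` here. -/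
theorem starRep_γ_symm_word (w : List Letter) :
    starRep (γ.symm (word w)) = path recipR 0 w := by
  rw [word, map_list_prod, map_list_prod, path, List.map_map, List.map_map]
  congr 2
  ext u : 1
  have hx : starRep x = step recipR 1 Letter.x := by simp [starRep, x]
  have hy : starRep y = step recipR 1 Letter.y := by simp [starRep, y]
  simp only [Function.comp_apply]
  cases u
  · change starRep (γ.symm x) = _
    rw [γ_symm_x, hx]
    rfl
  · change starRep (γ.symm y) = _
    rw [γ_symm_y, map_sub, hx, hy]
    ext f p
    simp only [LinearMap.sub_apply, Pi.sub_apply, step_x, step_y, add_zero, sum_range_succ]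
    ring

theorem word_induction {p : H → Prop} (hw : ∀ w, p (word w)) (h0 : p 0)
    (hadd : ∀ u v, p u → p v → p (u + v)) (hsmul : ∀ (a : ℚ) u, p u → p (a • u)) (u : H) : p u := by
  have hu : u ∈ Submodule.span ℚ (Set.range wordBasis) := by
    rw [wordBasis.span_eq]
    trivial
  induction hu using Submodule.span_induction with
  | mem v hv =>
    obtain ⟨w, rfl⟩ := hv
    rw [wordBasis_apply]
    exact hw _
  | zero => exact h0
  | add u v _ _ hu hv => exact hadd u v hu hv
  | smul a u _ hu => exact hsmul a u hu

/-- Stated as `HasSum` so that it extends linearly from words to elements with signs, such as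
`γ.symm (word w)`. -/
theorem hasSum_ZbarExt (u : H) :
    HasSum (fun p => recipR p * starRep u recipR p) (ZbarExt (x * u * y)) := by
  induction u using word_induction with
  | hw w =>
    have h : x * word w * y = word (Letter.x :: (w ++ [Letter.y])) := by
      simp [word_cons, word_append, word_nil, x, y, mul_assoc]
    rw [h, ZbarExt_word, zetaStar_exponents, starRep_word]
    exact hasSum_zetaE le_rfl w
  | h0 => simp
  | hadd u v hu hv =>
    simpa [mul_add, add_mul] using hu.add hv
  | hsmul a u hu =>
    have := hu.const_smul (a : ℝ)
    simp only [smul_eq_mul] at this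
    rw [mul_smul_comm, smul_mul_assoc, map_smul, map_smul, Rat.smul_def]
    convert this using 1
    ext p
    simp [Rat.smul_def, mul_left_comm]

theorem ZbarExt_x_mul_γ_symm_mul_y (w : List Letter) :
    ZbarExt (x * γ.symm (word w) * y) = (zetaE 0 w).toReal := by
  have h := hasSum_ZbarExt (γ.symm (word w))
  rw [starRep_γ_symm_word] at h
  exact h.unique (hasSum_zetaE (Nat.zero_le 1) w)

/-! ### The cyclic sum relations for words -/

theorem M_lact_ract_xyTensor (n : ℕ) (a b : H) :
    M (n + 1) (lact (n + 1) a (ract (n + 1) b (xyTensor (n + 1)))) = x * b * y ^ n * a * y := by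
  have h : Function.update (Function.update (Fin.cons x fun _ : Fin (n + 1) => y) 0 (x * b))
      (Fin.last (n + 1)) (a * y) =
      (Fin.cons (x * b) (Fin.snoc (fun _ : Fin n => y) (a * y)) : Fin (n + 2) → H) := by
    rw [Fin.update_cons_zero, ← Fin.succ_last, ← Fin.cons_update]
    congr 1
    ext i
    induction i using Fin.lastCases with
    | last => simp
    | cast i => simp [Fin.castSucc_ne_last]
  rw [xyTensor, ract_tprod, lact_tprod, M_tprod]
  have h0 : (Function.update (Fin.cons x fun _ : Fin (n + 1) => y : Fin (n + 2) → H) 0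
      ((Fin.cons x fun _ : Fin (n + 1) => y : Fin (n + 2) → H) 0 * b)) (Fin.last (n + 1)) = y := by
    rw [← Fin.succ_last, Function.update_of_ne (Fin.succ_ne_zero _), Fin.cons_succ]
  rw [h0, Fin.cons_zero, h, List.ofFn_cons, List.prod_cons, List.ofFn_succ']
  simp [List.ofFn_const, mul_assoc, List.concat_eq_append]

theorem CbarLetter_eq (n : ℕ) (u : Letter) : CbarLetter n u = sgn u • xyTensor n := by
  cases u
  · exact (one_smul ℚ _).symm
  · exact (neg_one_smul ℚ _).symm

theorem lact_CbarWord_cons (n : ℕ) (a : H) (u : Letter) (w : List Letter) :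
    lact n a (CbarWord n (u :: w)) =
      sgn u • lact n a (ract n (γ.symm (word w)) (xyTensor n)) +
        lact n (a * γ.symm (word [u])) (CbarWord n w) := by
  rw [CbarWord, CbarLetter_eq, map_add, map_smul, map_smul, lact_mul]
  simp [word]

theorem M_lact_CbarWord_cons (n : ℕ) (a : H) (u : Letter) (w : List Letter) :
    M (n + 1) (lact (n + 1) a (CbarWord (n + 1) (u :: w))) =
      sgn u • (x * γ.symm (word w) * y ^ n * a * y) +
        M (n + 1) (lact (n + 1) (a * γ.symm (word [u])) (CbarWord (n + 1) w)) := by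
  rw [lact_CbarWord_cons, map_add, map_smul, M_lact_ract_xyTensor]

/-- The telescoping itself: `v` holds the letters already passed, and peeling off the next one
contributes a single rotation step. With `v` empty the two ends coincide. -/
theorem ZbarExt_lact_CbarWord (v w : List Letter) (hx : Letter.x ∈ v ++ w)
    (hy : Letter.y ∈ v ++ w) :
    ZbarExt (M 1 (lact 1 (γ.symm (word v)) (CbarWord 1 w))) =
      (connE (v ++ w)).toReal - (connE (w ++ v)).toReal := by
  induction w generalizing v with
  | nil => simp [CbarWord]
  | cons u w ih =>
    have h := sgn_mul_zetaE u (w := w ++ v) (by simp at hx ⊢; tauto) (by simp at hy ⊢; tauto)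
    have h2 := ih (v ++ [u]) (by simpa using hx) (by simpa using hy)
    rw [M_lact_CbarWord_cons, map_add, map_smul, ← map_mul, ← word_append, h2, pow_zero, mul_one,
      mul_assoc x, ← map_mul, ← word_append, ZbarExt_x_mul_γ_symm_mul_y, Rat.smul_def, h]
    simp

theorem ZbarExt_rhobar_one_word {w : List Letter} (hx : Letter.x ∈ w) (hy : Letter.y ∈ w) :
    ZbarExt (rhobar 1 (word w)) = 0 := by
  have h := ZbarExt_lact_CbarWord [] w hx hy
  rw [word_nil, map_one, lact_one, List.nil_append, List.append_nil, sub_self] at h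
  rwa [rhobar, LinearMap.comp_apply, Cbar_word]

theorem x_mul_mul_y_mem_H0 (a : H) : x * a * y ∈ H0 :=
  Submodule.mem_sup_right ⟨a, by simp [mul_assoc]⟩

theorem M_lact_CbarWord_mem_H0 (n : ℕ) (a : H) (w : List Letter) :
    M (n + 1) (lact (n + 1) a (CbarWord (n + 1) w)) ∈ H0 := by
  induction w generalizing a with
  | nil => simp [CbarWord]
  | cons u w ih =>
    rw [M_lact_CbarWord_cons]
    refine add_mem (H0.smul_mem _ ?_) (ih _)
    rw [mul_assoc x, mul_assoc x]
    exact x_mul_mul_y_mem_H0 _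

theorem rhobar_mem_H0 (n : ℕ) (v : H) : rhobar (n + 1) v ∈ H0 := by
  induction v using word_induction with
  | hw w =>
    have h := M_lact_CbarWord_mem_H0 n 1 w
    rwa [lact_one, ← Cbar_word] at h
  | h0 => simp
  | hadd u v hu hv => rw [map_add]; exact add_mem hu hv
  | hsmul a u hu => rw [map_smul]; exact H0.smul_mem a hu

/-! ### Reduction to `n = 1` -/

theorem Cbar_mul_pow_x_add_y (n m : ℕ) (v : H) :
    Cbar n (v * (x + y) ^ m) = ract n (y ^ m) (Cbar n v) := by
  induction m with
  | zero => simp [ract_one]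
  | succ m ih =>
    rw [pow_succ, ← mul_assoc, Cbar_mul, ih, γ_symm_add, map_add (Cbar n), Cbar_x, Cbar_y,
      add_neg_cancel, map_zero, add_zero, pow_succ, ract_mul]

/-- The `n` extra factors `y` sit just after the first tensor factor, so right multiplication of
that factor by `y ^ n` has the same effect. -/
theorem M_lact_CbarWord_eq (n : ℕ) (a : H) (w : List Letter) :
    M (n + 1) (lact (n + 1) a (CbarWord (n + 1) w)) =
      M 1 (ract 1 (y ^ n) (lact 1 a (CbarWord 1 w))) := by
  induction w generalizing a with
  | nil => simp [CbarWord]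
  | cons u w ih =>
    rw [M_lact_CbarWord_cons, lact_CbarWord_cons, map_add, map_add, map_smul, map_smul, ih,
      ← lact_ract 1 a, ← ract_mul, M_lact_ract_xyTensor 0]
    simp [mul_assoc]

theorem rhobar_eq_rhobar_one (n : ℕ) (v : H) :
    rhobar (n + 1) v = rhobar 1 (v * (x + y) ^ n) := by
  rw [rhobar, rhobar, LinearMap.comp_apply, LinearMap.comp_apply, Cbar_mul_pow_x_add_y]
  induction v using word_induction with
  | hw w =>
    have h := M_lact_CbarWord_eq n 1 w
    rwa [lact_one, lact_one, ← Cbar_word, ← Cbar_word] at h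
  | h0 => simp
  | hadd u v hu hv => simp only [map_add, hu, hv]
  | hsmul a u hu => simp only [map_smul, hu]

/-! ### The span of the words containing both letters -/

/-- The span of the words containing both letters. -/
def mixed : Submodule ℚ H :=
  Submodule.span ℚ (word '' {w | Letter.x ∈ w ∧ Letter.y ∈ w})

theorem ZbarExt_rhobar_one_of_mem_mixed {v : H} (hv : v ∈ mixed) : ZbarExt (rhobar 1 v) = 0 := by
  suffices h : mixed ≤ LinearMap.ker (ZbarExt ∘ₗ rhobar 1) from h hv
  refine Submodule.span_le.2 ?_
  rintro _ ⟨w, ⟨hx, hy⟩, rfl⟩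
  exact ZbarExt_rhobar_one_word hx hy

theorem mixed_mul_word {v : H} (hv : v ∈ mixed) (u : List Letter) : v * word u ∈ mixed := by
  suffices h : mixed ≤ mixed.comap (LinearMap.mulRight ℚ (word u)) from h hv
  refine Submodule.span_le.2 ?_
  rintro _ ⟨w, ⟨hx, hy⟩, rfl⟩
  refine Submodule.subset_span ⟨w ++ u, ⟨?_, ?_⟩, word_append w u⟩ <;> simp [hx, hy]

theorem word_singleton_x : word [Letter.x] = x := by simp [word, x]

theorem word_singleton_y : word [Letter.y] = y := by simp [word, y]

theorem mixed_mul_pow_x_add_y {v : H} (hv : v ∈ mixed) (n : ℕ) : v * (x + y) ^ n ∈ mixed := by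
  induction n with
  | zero => simpa using hv
  | succ n ih =>
    rw [pow_succ, ← mul_assoc, mul_add, ← word_singleton_x, ← word_singleton_y]
    rw [← word_singleton_x, ← word_singleton_y] at ih
    exact add_mem (mixed_mul_word ih _) (mixed_mul_word ih _)

theorem word_eq_x_pow {w : List Letter} (h : Letter.y ∉ w) : word w = x ^ w.length := by
  have : w = List.replicate w.length Letter.x :=
    List.eq_replicate_iff.2 ⟨rfl, fun u hu => by cases u <;> simp_all⟩
  rw [this]
  simp [word, x]

theorem word_eq_y_pow {w : List Letter} (h : Letter.x ∉ w) : word w = y ^ w.length := by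
  have : w = List.replicate w.length Letter.y :=
    List.eq_replicate_iff.2 ⟨rfl, fun u hu => by cases u <;> simp_all⟩
  rw [this]
  simp [word, y]

/-- The evaluation `x ↦ a`, `y ↦ 0`. -/
def evalX (a : ℚ) : H →ₐ[ℚ] ℚ :=
  FreeAlgebra.lift ℚ fun u => match u with | Letter.x => a | Letter.y => 0

/-- Only the constant term survives `y ↦ 0`; this excludes positive powers of `x` from `H1`. -/
theorem evalX_eq_of_mem_H1 {v : H} (hv : v ∈ H1) (a b : ℚ) : evalX a v = evalX b v := by
  have hy : ∀ a, evalX a y = 0 := fun a => by simp [evalX, y]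
  obtain ⟨c, hc, d, ⟨e, rfl⟩, rfl⟩ := Submodule.mem_sup.1 hv
  obtain ⟨t, rfl⟩ := Submodule.mem_span_singleton.1 hc
  simp [hy]

theorem H1Check_le_mixed : H1Check ≤ mixed := by
  refine Submodule.span_le.2 ?_
  rintro _ ⟨h1, ⟨w, rfl⟩, hw⟩
  refine Submodule.subset_span ⟨w, ⟨?_, ?_⟩, rfl⟩
  · by_contra h
    exact hw _ (word_eq_y_pow h)
  · by_contra h
    rw [word_eq_x_pow h] at h1
    have hx : ∀ a, evalX a x = a := fun a => by simp [evalX, x]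
    have h2 := evalX_eq_of_mem_H1 h1 1 0
    rw [map_pow, map_pow, hx, hx, one_pow] at h2
    by_cases hl : w.length = 0
    · refine hw 0 ?_
      rw [word_eq_x_pow h, hl, pow_zero, pow_zero]
    · simp [hl] at h2

theorem rhobar_H1Check_le (n : ℕ) (hn : 1 ≤ n) :
    Submodule.map (rhobar n) H1Check ≤ Submodule.map H0.subtype (LinearMap.ker Zbar) := by
  obtain ⟨n, rfl⟩ := Nat.exists_eq_add_of_le' hn
  rintro _ ⟨v, hv, rfl⟩
  refine ⟨⟨rhobar (n + 1) v, rhobar_mem_H0 n v⟩, ?_, rfl⟩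
  change ZbarExt (rhobar (n + 1) v) = 0
  rw [rhobar_eq_rhobar_one]
  exact ZbarExt_rhobar_one_of_mem_mixed (mixed_mul_pow_x_add_y (H1Check_le_mixed hv) n)

/-! ### The cyclic sum formula -/

theorem Cbar_γ_mul (n : ℕ) (v v' : H) :
    Cbar n (γ (v * v')) = ract n v' (Cbar n (γ v)) + lact n v (Cbar n (γ v')) := by
  rw [map_mul, Cbar_mul, AlgEquiv.symm_apply_apply, AlgEquiv.symm_apply_apply]

theorem Cbar_γ_y (n : ℕ) : Cbar n (γ y) = 0 := by
  rw [γ_y, map_add, Cbar_x, Cbar_y, add_neg_cancel]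

/-- The derivation marks one of the `n` letters `x`; `i` counts those before it, which `M` carries
to the end of the word. -/
theorem M_Cbar_γ_x_pow (n : ℕ) (a b : H) :
    M 1 (lact 1 a (ract 1 b (Cbar 1 (γ (x ^ n))))) =
      ∑ i ∈ range n, x * x ^ (n - 1 - i) * b * a * x ^ i * y := by
  induction n generalizing a b with
  | zero =>
    have h : Cbar 1 1 = 0 := by simpa [word_nil, CbarWord] using Cbar_word 1 []
    simp [h]
  | succ n ih =>
    rw [pow_succ', Cbar_γ_mul, map_add, map_add, map_add, ← ract_mul, ← lact_ract, ← lact_mul, ih,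
      γ_x, Cbar_x, M_lact_ract_xyTensor 0, sum_range_succ', add_comm]
    congr 1
    · refine sum_congr rfl fun i _ => ?_
      rw [show n + 1 - 1 - (i + 1) = n - 1 - i by omega, pow_succ' x i]
      simp only [mul_assoc]
    · simp [mul_assoc]

theorem M_Cbar_γ_z (c : ℕ) (a b : H) :
    M 1 (lact 1 a (ract 1 b (Cbar 1 (γ (z c))))) =
      ∑ i ∈ Icc 1 (c - 1), z (c - i + 1) * b * a * z i := by
  rw [z, Cbar_γ_mul, Cbar_γ_y, map_zero, add_zero, ← ract_mul, M_Cbar_γ_x_pow]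
  refine sum_nbij' (· + 1) (· - 1) ?_ ?_ ?_ ?_ ?_
  · intro i hi
    have := mem_range.1 hi
    exact mem_Icc.2 ⟨by omega, by omega⟩
  · intro i hi
    have := mem_Icc.1 hi
    exact mem_range.2 (by omega)
  · intro i _
    simp
  · intro i hi
    have := mem_Icc.1 hi
    omega
  · intro i hi
    have := mem_range.1 hi
    rw [z, z, ← pow_succ', show c - 1 - 1 - i + 1 = c - (i + 1) + 1 - 1 by omega,
      Nat.add_sub_cancel]
    simp only [mul_assoc, Nat.add_sub_cancel]

theorem zWord_cons (c : ℕ) (k : List ℕ) : zWord (c :: k) = z c * zWord k := by simp [zWord]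

theorem M_Cbar_γ_zWord (k : List ℕ) (a b : H) :
    M 1 (lact 1 a (ract 1 b (Cbar 1 (γ (zWord k))))) =
      ∑ j : Fin k.length, ∑ i ∈ Icc 1 (k.get j - 1),
        z (k.get j - i + 1) * zWord (k.drop (j + 1)) * b * a * zWord (k.take j) * z i := by
  induction k generalizing a b with
  | nil =>
    have h : Cbar 1 1 = 0 := by simpa [word_nil, CbarWord] using Cbar_word 1 []
    simp [zWord, h]
  | cons c k ih =>
    rw [zWord_cons, Cbar_γ_mul, map_add, map_add, map_add, ← ract_mul, ← lact_ract, ← lact_mul, ih,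
      M_Cbar_γ_z]
    refine Eq.trans ?_ (Fin.sum_univ_succ (n := k.length) _).symm
    congr 1
    · refine sum_congr rfl fun i _ => ?_
      simp [zWord, mul_assoc]
    · refine sum_congr rfl fun j _ => sum_congr rfl fun i _ => ?_
      simp [zWord_cons, mul_assoc]

theorem rhobar_one_γ_zWord (k : List ℕ) :
    rhobar 1 (γ (zWord k)) = ∑ j : Fin k.length, ∑ i ∈ Icc 1 (k.get j - 1),
      zWord (cyclicIndex k j i) := by
  have h := M_Cbar_γ_zWord k 1 1
  rw [lact_one, ract_one] at h
  rw [rhobar, LinearMap.comp_apply, h]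
  refine sum_congr rfl fun j _ => sum_congr rfl fun i _ => ?_
  simp [cyclicIndex, zWord, mul_assoc]

theorem rhobar_one_x_pow (n : ℕ) : rhobar 1 (x ^ n) = n • z (n + 1) := by
  have h := M_Cbar_γ_x_pow n 1 1
  rw [lact_one, ract_one, map_pow, γ_x] at h
  rw [rhobar, LinearMap.comp_apply, h, sum_congr rfl (g := fun _ => z (n + 1)), sum_const,
    card_range]
  intro i hi
  have := mem_range.1 hi
  rw [mul_one, mul_one, ← pow_succ', ← pow_add, z]
  congr 2
  omega

theorem rhobar_one_cyclic (k : List ℕ) :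
    rhobar 1 (γ (zWord k) - x ^ k.sum) =
      (∑ j : Fin k.length, ∑ i ∈ Icc 1 (k.get j - 1), zWord (cyclicIndex k j i)) -
        k.sum • z (k.sum + 1) := by
  rw [map_sub, rhobar_one_γ_zWord, rhobar_one_x_pow]

/-! ### The words occurring in `γ(z_{k_1} ⋯ z_{k_l}) - x^k` -/

/-- Choosing `x` in every factor `x + y` gives the pure power of `x`; any other choice keeps a `y`,
and letters `x` of `u` are never lost. -/
theorem γ_word_sub_x_pow_mem (u : List Letter) :
    γ (word u) - x ^ u.length ∈ Submodule.span ℚ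
      (word '' {w | (Letter.x ∈ u → Letter.x ∈ w) ∧ Letter.y ∈ w}) := by
  induction u with
  | nil => simp [word_nil]
  | cons b u ih =>
    have hmul : ∀ c : Letter, (b = Letter.x → c = Letter.x) →
        word [c] * (γ (word u) - x ^ u.length) ∈ Submodule.span ℚ
          (word '' {w | (Letter.x ∈ b :: u → Letter.x ∈ w) ∧ Letter.y ∈ w}) := by
      intro c hc
      refine (Submodule.span_le (p := (Submodule.span ℚ (word '' {w | (Letter.x ∈ b :: u →
        Letter.x ∈ w) ∧ Letter.y ∈ w})).comap (LinearMap.mulLeft ℚ (word [c])))).2 ?_ ih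
      rintro _ ⟨w, ⟨hx, hy⟩, rfl⟩
      refine Submodule.subset_span ⟨c :: w, ⟨fun h => ?_, by simp [hy]⟩, ?_⟩
      · rcases List.mem_cons.1 h with h | h
        · simp [hc h.symm]
        · simp [hx h]
      · rw [← List.singleton_append, word_append]
        rfl
    cases b
    · have h := hmul Letter.x fun h => h
      have e : γ (word (Letter.x :: u)) - x ^ (Letter.x :: u).length =
          word [Letter.x] * (γ (word u) - x ^ u.length) := by
        rw [← List.singleton_append, word_append, map_mul, word_singleton_x, γ_x, mul_sub,
          List.length_append, List.length_singleton, add_comm, pow_succ']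
      rwa [e]
    · have e : γ (word (Letter.y :: u)) - x ^ (Letter.y :: u).length =
          word [Letter.x] * (γ (word u) - x ^ u.length) +
            word [Letter.y] * (γ (word u) - x ^ u.length) +
              word (Letter.y :: List.replicate u.length Letter.x) := by
        have h1 : word (List.replicate u.length Letter.x) = x ^ u.length := by
          simp [word, x]
        rw [← List.singleton_append (l := u), ← List.singleton_append (l := List.replicate _ _),
          word_append, word_append, h1, map_mul, word_singleton_x, word_singleton_y, γ_y,
          List.length_append, List.length_singleton, add_comm 1, pow_succ']
        noncomm_ring
      rw [e]
      refine add_mem (add_mem (hmul _ (by simp)) (hmul _ (by simp))) (Submodule.subset_span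
        ⟨_, ⟨fun h => ?_, by simp⟩, rfl⟩)
      -- The leftover word is `y` followed by as many `x` as `u` has letters, and `u` is nonempty.
      have hu : Letter.x ∈ u := by simpa using h
      simpa [List.mem_replicate] using List.ne_nil_of_mem hu

theorem zWord_eq_word_flatMap (k : List ℕ) :
    zWord k = word (k.flatMap fun a => List.replicate (a - 1) Letter.x ++ [Letter.y]) := by
  induction k with
  | nil => rfl
  | cons a k ih =>
    have h : word (List.replicate (a - 1) Letter.x) = x ^ (a - 1) := by simp [word, x]
    rw [zWord_cons, ih, List.flatMap_cons, word_append, word_append, z, word_singleton_y, h]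

theorem length_flatMap_zWord (k : List ℕ) (hk : ∀ a ∈ k, 1 ≤ a) :
    (k.flatMap fun a => List.replicate (a - 1) Letter.x ++ [Letter.y]).length = k.sum := by
  induction k with
  | nil => rfl
  | cons a k ih =>
    have ha := hk a List.mem_cons_self
    rw [List.flatMap_cons, List.length_append, ih fun b hb => hk b (List.mem_cons_of_mem _ hb)]
    simp
    omega

theorem γ_zWord_sub_x_pow_mem_mixed (k : List ℕ) (hk : ∀ a ∈ k, 1 ≤ a) (h1 : ∃ a ∈ k, 1 < a) :
    γ (zWord k) - x ^ k.sum ∈ mixed := by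
  have h := γ_word_sub_x_pow_mem
    (k.flatMap fun a => List.replicate (a - 1) Letter.x ++ [Letter.y])
  rw [length_flatMap_zWord k hk, ← zWord_eq_word_flatMap] at h
  refine Submodule.span_mono (Set.image_mono ?_) h
  rintro w ⟨hx, hy⟩
  refine ⟨hx ?_, hy⟩
  obtain ⟨a, ha, h1⟩ := h1
  refine List.mem_flatMap.2 ⟨a, ha, List.mem_append_left _ (List.mem_replicate.2 ⟨?_, rfl⟩)⟩
  omega

theorem zetaStar_singleton (n : ℕ) : zetaStar [n] = ∑' m : ℕ+, 1 / ((m : ℕ) : ℝ) ^ n := by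
  let e : ℕ+ ≃ {m : Fin [n].length → ℕ+ // Antitone m} :=
    { toFun := fun m => ⟨fun _ => m, antitone_const⟩
      invFun := fun m => m.1 ⟨0, by simp⟩
      left_inv := fun m => rfl
      right_inv := fun m => by
        ext i
        have : i = ⟨0, by simp⟩ := Subsingleton.elim (α := Fin 1) _ _
        rw [this] }
  rw [zetaStar, ← e.tsum_eq]
  congr 1
  ext m
  simp [e]

theorem cyclicIndex_pos {k : List ℕ} (hk : ∀ a ∈ k, 1 ≤ a) (j : Fin k.length) {i : ℕ}
    (hi : 1 ≤ i) : ∀ a ∈ cyclicIndex k j i, 1 ≤ a := by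
  intro a ha
  simp only [cyclicIndex, List.mem_cons, List.mem_append, List.not_mem_nil, or_false] at ha
  rcases ha with rfl | (ha | ha) | rfl
  · omega
  · exact hk a (List.mem_of_mem_drop ha)
  · exact hk a (List.mem_of_mem_take ha)
  · exact hi

theorem cyclic_sum_formula (k : List ℕ) (hk : ∀ a ∈ k, 1 ≤ a) (h1 : ∃ a ∈ k, 1 < a) :
    ∑ j : Fin k.length, ∑ i ∈ Icc 1 (k.get j - 1), zetaStar (cyclicIndex k j i) =
      (k.sum : ℝ) * ∑' m : ℕ+, 1 / ((m : ℕ) : ℝ) ^ (k.sum + 1) := by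
  have h := ZbarExt_rhobar_one_of_mem_mixed (γ_zWord_sub_x_pow_mem_mixed k hk h1)
  have hz : z (k.sum + 1) = zWord [k.sum + 1] := by simp [zWord]
  rw [rhobar_one_cyclic, map_sub, sub_eq_zero, map_nsmul, hz, ZbarExt_zWord _ (by simp),
    zetaStar_singleton, nsmul_eq_mul, map_sum] at h
  rw [← h]
  refine sum_congr rfl fun j _ => ?_
  rw [map_sum]
  refine sum_congr rfl fun i hi => ?_
  rw [ZbarExt_zWord _ (cyclicIndex_pos hk j (mem_Icc.1 hi).1)]

end CSF

end

theorem mainTheorem2 :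
    (∀ n : ℕ, 1 ≤ n →
      Submodule.map (CSF.rhobar n) CSF.H1Check ≤
        Submodule.map CSF.H0.subtype (LinearMap.ker CSF.Zbar)) ∧
    (∀ k : List ℕ, (∀ a ∈ k, 1 ≤ a) →
      CSF.rhobar 1 (CSF.γ (CSF.zWord k) - CSF.x ^ k.sum) =
        (∑ j : Fin k.length, ∑ i ∈ Finset.Icc 1 (k.get j - 1),
          CSF.zWord (CSF.cyclicIndex k j i)) - k.sum • CSF.z (k.sum + 1)) ∧
    (∀ k : List ℕ, (∀ a ∈ k, 1 ≤ a) → (∃ a ∈ k, 1 < a) →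
      ∑ j : Fin k.length, ∑ i ∈ Finset.Icc 1 (k.get j - 1),
          CSF.zetaStar (CSF.cyclicIndex k j i) =
        (k.sum : ℝ) * ∑' m : ℕ+, 1 / ((m : ℕ) : ℝ) ^ (k.sum + 1)) :=
  ⟨CSF.rhobar_H1Check_le, fun k _ => CSF.rhobar_one_cyclic k, CSF.cyclic_sum_formula⟩
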